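/- Let $I$ be a finite set (for instance $I=\{1,\dots,n\}$). Let $\Pi_{\mathrm{NAP}}(I)$ be the set of forests of rooted trees with vertex set $I$, that is, of partitions of $I$ into nonempty blocks together with a rooted tree on each block. For $x\in\Pi_{\mathrm{NAP}}(I)$ let $\pi_x$ be the set of its trees. For $\theta\in\Pi_{\mathrm{NAP}}(\pi_x)$ let $\theta\circ x\in\Pi_{\mathrm{NAP}}(I)$ be the forest obtained from $x$ by adding, for every edge of $\theta$ between two trees $s$ and $s'$ of $x$, an edge between the root of $s$ and the root of $s'$; the root of each resulting tree is the root of the tree of $x$ which is the root of the corresponding tree of $\theta$. Order $\Pi_{\mathrm{NAP}}(I)$ by: $x\le y$ if and only if $y=\theta\circ x$ for some $\theta\in\Pi_{\mathrm{NAP}}(\pi_x)$. A finite bounded poset $P$ is called Cohen–Macaulay over a commutative ring $k$ if all its maximal chains have the same length and, for all $x<y$ in $P$, the reduced simplicial homology $\widetilde H_i(\Delta(x,y);k)$ of the order complex of the open interval $(x,y)$ vanishes for every $i\neq \ell(x,y)-2$, where $\ell(x,y)$ is the length of the maximal chains of $[x,y]$. **Corollary.** Every maximal interval of $\Pi_{\mathrm{NAP}}(I)$,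 that is, every interval $[a,b]$ with $a\le b$, $a$ a minimal and $b$ a maximal element of $\Pi_{\mathrm{NAP}}(I)$, is Cohen–Macaulay over every commutative ring $k$. -/

import Mathlib

universe u v w

/-- If `f` sends every edge of `G` to an edge of `H` or collapses it, then `f` preserves
reachability. -/
theorem reachable_of_adj_or_eq {V : Type v} {W : Type w} {G : SimpleGraph V} {H : SimpleGraph W}
    (f : V → W) (h : ∀ a b, G.Adj a b → H.Adj (f a) (f b) ∨ f a = f b) {a b : V}
    (hab : G.Reachable a b) : H.Reachable (f a) (f b) := by
  obtain ⟨p⟩ := hab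
  induction p with
  | nil => exact SimpleGraph.Reachable.refl _
  | cons hadj _ ih =>
    rcases h _ _ hadj with h1 | h1
    · exact h1.reachable.trans ih
    · rw [h1]; exact ih

/-- A forest of rooted trees with vertex set `I`: a graph without cycles on `I` together with the
choice of exactly one root in each connected component.  Such a forest is the same thing as a
partition of `I` into nonempty blocks (the vertex sets of the components) together with a rooted
tree, that is, an element of `NAP(J)`, on each block `J`.  So this type is the set `Π_NAP(I)`, and
the elements of `NAP(I)` are the forests whose graph is connected. -/
@[ext]
structure RootedForest (I : Type u) where
  /-- the underlying graph -/
  graph : SimpleGraph I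
  /-- the set of the roots of all the components -/
  roots : Set I
  acyclic : graph.IsAcyclic
  existsUnique_root : ∀ c : graph.ConnectedComponent,
    ∃! r : I, graph.connectedComponentMk r = c ∧ r ∈ roots

namespace RootedForest

variable {I : Type u}

/-- The set `π_x` of the blocks (the trees) of the forest `x`. -/
abbrev Block (x : RootedForest I) : Type u := x.graph.ConnectedComponent

/-- The root of a tree of the forest `x`. -/
noncomputable def root (x : RootedForest I) (c : x.Block) : I :=
  (x.existsUnique_root c).choose

theorem mk_root (x : RootedForest I) (c : x.Block) :
    x.graph.connectedComponentMk (x.root c) = c :=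
  (x.existsUnique_root c).choose_spec.1.1

theorem root_mem (x : RootedForest I) (c : x.Block) : x.root c ∈ x.roots :=
  (x.existsUnique_root c).choose_spec.1.2

theorem root_injective (x : RootedForest I) : Function.Injective x.root := fun c d h => by
  rw [← x.mk_root c, ← x.mk_root d, h]

theorem root_mk_of_mem (x : RootedForest I) {r : I} (hr : r ∈ x.roots) :
    x.root (x.graph.connectedComponentMk r) = r :=
  ((x.existsUnique_root (x.graph.connectedComponentMk r)).unique
    ⟨x.mk_root _, x.root_mem _⟩ ⟨rfl, hr⟩)

theorem eq_of_roots_of_reachable (x : RootedForest I) {r s : I} (hr : r ∈ x.roots)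
    (hs : s ∈ x.roots) (h : x.graph.Reachable r s) : r = s := by
  rw [← x.root_mk_of_mem hr, ← x.root_mk_of_mem hs, SimpleGraph.ConnectedComponent.eq.2 h]

theorem reachable_root (x : RootedForest I) (v : I) :
    x.graph.Reachable v (x.root (x.graph.connectedComponentMk v)) :=
  SimpleGraph.ConnectedComponent.exact (x.mk_root _).symm

/-- The graph of a composite: the edges of `x`, and for each edge of `θ` between two blocks of `x`,
an edge between the roots of these blocks. -/
noncomputable def compGraph (x : RootedForest I) (θ : RootedForest x.Block) : SimpleGraph I :=
  x.graph ⊔ θ.graph.map x.root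

theorem compGraph_adj (x : RootedForest I) (θ : RootedForest x.Block) {a b : I} :
    (x.compGraph θ).Adj a b ↔
      x.graph.Adj a b ∨ ∃ c d, θ.graph.Adj c d ∧ x.root c = a ∧ x.root d = b := by
  simp only [compGraph, SimpleGraph.sup_adj, SimpleGraph.map_adj']
  constructor
  · rintro (h | ⟨-, h⟩)
    · exact Or.inl h
    · exact Or.inr h
  · rintro (h | ⟨c, d, h, rfl, rfl⟩)
    · exact Or.inl h
    · exact Or.inr ⟨fun e => h.ne (x.root_injective e), c, d, h, rfl, rfl⟩

theorem compGraph_acyclic (x : RootedForest I) (θ : RootedForest x.Block) :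
    (x.compGraph θ).IsAcyclic := by
  classical
  rw [SimpleGraph.isAcyclic_iff_forall_adj_isBridge]
  intro a b hab
  rw [SimpleGraph.isBridge_iff]
  intro hr
  rcases (x.compGraph_adj θ).1 hab with h | ⟨c, d, h, rfl, rfl⟩
  · -- retract onto the block of `a`
    have hbr := SimpleGraph.isAcyclic_iff_forall_adj_isBridge.1 x.acyclic h
    rw [SimpleGraph.isBridge_iff] at hbr
    set C := x.graph.connectedComponentMk a with hC
    have hb : x.graph.connectedComponentMk b = C :=
      (SimpleGraph.ConnectedComponent.eq.2 h.reachable).symm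
    let f : I → I := fun v => if x.graph.connectedComponentMk v = C then v else x.root C
    have key := reachable_of_adj_or_eq (H := x.graph.deleteEdges {s(a, b)}) f (by
      intro p q hpq
      rw [SimpleGraph.deleteEdges_adj] at hpq
      obtain ⟨hpq, hne⟩ := hpq
      rcases (x.compGraph_adj θ).1 hpq with h1 | ⟨c, d, h1, rfl, rfl⟩
      · have e : x.graph.connectedComponentMk p = x.graph.connectedComponentMk q :=
          SimpleGraph.ConnectedComponent.eq.2 h1.reachable
        by_cases hp : x.graph.connectedComponentMk p = C
        · left
          have hq : x.graph.connectedComponentMk q = C := e ▸ hp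
          simp only [f, hp, hq, if_true]
          exact SimpleGraph.deleteEdges_adj.2 ⟨h1, hne⟩
        · right
          have hq : ¬ x.graph.connectedComponentMk q = C := e ▸ hp
          simp only [f, hp, hq, if_false]
      · right
        have aux : ∀ c, f (x.root c) = x.root C := by
          intro c
          simp only [f, x.mk_root]
          split_ifs with hc
          · rw [hc]
          · rfl
        rw [aux, aux]) hr
    have hfa : f a = a := by simp [f, hC]
    have hfb : f b = b := by simp [f, hb]
    rw [hfa, hfb] at key
    exact hbr key
  · -- contract the blocks
    have hbr := SimpleGraph.isAcyclic_iff_forall_adj_isBridge.1 θ.acyclic h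
    rw [SimpleGraph.isBridge_iff] at hbr
    have key := reachable_of_adj_or_eq (H := θ.graph.deleteEdges {s(c, d)})
      x.graph.connectedComponentMk (by
      intro p q hpq
      rw [SimpleGraph.deleteEdges_adj] at hpq
      obtain ⟨hpq, hne⟩ := hpq
      rcases (x.compGraph_adj θ).1 hpq with h1 | ⟨c', d', h1, rfl, rfl⟩
      · exact Or.inr (SimpleGraph.ConnectedComponent.eq.2 h1.reachable)
      · left
        rw [x.mk_root, x.mk_root]
        refine SimpleGraph.deleteEdges_adj.2 ⟨h1, fun he => hne ?_⟩
        have := congrArg (Sym2.map x.root) (Set.mem_singleton_iff.1 he)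
        simpa using this) hr
    rw [x.mk_root, x.mk_root] at key
    exact hbr key

theorem compGraph_reachable_iff (x : RootedForest I) (θ : RootedForest x.Block) {a b : I} :
    (x.compGraph θ).Reachable a b ↔
      θ.graph.Reachable (x.graph.connectedComponentMk a) (x.graph.connectedComponentMk b) := by
  constructor
  · refine reachable_of_adj_or_eq x.graph.connectedComponentMk (fun p q hpq => ?_)
    rcases (x.compGraph_adj θ).1 hpq with h1 | ⟨c, d, h1, rfl, rfl⟩
    · exact Or.inr (SimpleGraph.ConnectedComponent.eq.2 h1.reachable)
    · left
      rwa [x.mk_root, x.mk_root]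
  · intro h
    have h1 := reachable_of_adj_or_eq (H := x.compGraph θ) x.root
      (fun c d hcd => Or.inl ((x.compGraph_adj θ).2 (Or.inr ⟨c, d, hcd, rfl, rfl⟩))) h
    have hle : x.graph ≤ x.compGraph θ := le_sup_left
    exact ((x.reachable_root a).mono hle).trans (h1.trans ((x.reachable_root b).mono hle).symm)

/-- The composite of `θ ∈ Π_NAP(π_x)` with the family of the trees of `x`: to the forest `x`, add
for each edge of `θ` between two blocks an edge between the roots of these blocks; the root of each
resulting tree is the root of the block which is the root of the corresponding tree of `θ`. -/
noncomputable def comp (x : RootedForest I) (θ : RootedForest x.Block) : RootedForest I where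
  graph := x.compGraph θ
  roots := x.root '' θ.roots
  acyclic := x.compGraph_acyclic θ
  existsUnique_root := by
    intro C
    induction C using SimpleGraph.ConnectedComponent.ind with
    | _ v =>
    refine ⟨x.root (θ.root (θ.graph.connectedComponentMk (x.graph.connectedComponentMk v))),
      ⟨?_, _, θ.root_mem _, rfl⟩, ?_⟩
    · rw [SimpleGraph.ConnectedComponent.eq, compGraph_reachable_iff, x.mk_root]
      exact (θ.reachable_root _).symm
    · rintro _ ⟨h, c, hc, rfl⟩
      rw [SimpleGraph.ConnectedComponent.eq, compGraph_reachable_iff, x.mk_root] at h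
      rw [← SimpleGraph.ConnectedComponent.eq.2 h, θ.root_mk_of_mem hc]

/-- The order of the poset `Π_NAP(I)`: `x ≤ y` if there is `θ ∈ Π_NAP(π_x)` whose composite with
`x` is `y`. -/
instance : LE (RootedForest I) where
  le x y := ∃ θ : RootedForest x.Block, x.comp θ = y

theorem le_def {x y : RootedForest I} : x ≤ y ↔ ∃ θ : RootedForest x.Block, x.comp θ = y :=
  Iff.rfl

/-- A description of the order without composites, used to check that it is an order. -/
theorem le_iff {x y : RootedForest I} :
    x ≤ y ↔ x.graph ≤ y.graph ∧ y.roots ⊆ x.roots ∧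
      ∀ a b, y.graph.Adj a b → x.graph.Adj a b ∨ (a ∈ x.roots ∧ b ∈ x.roots) := by
  constructor
  · rintro ⟨θ, rfl⟩
    refine ⟨le_sup_left, ?_, fun a b h => ?_⟩
    · rintro _ ⟨c, -, rfl⟩
      exact x.root_mem c
    · rcases (x.compGraph_adj θ).1 h with h1 | ⟨c, d, -, rfl, rfl⟩
      · exact Or.inl h1
      · exact Or.inr ⟨x.root_mem c, x.root_mem d⟩
  · rintro ⟨hg, hr, he⟩
    let H : SimpleGraph x.Block := y.graph.comap x.root
    -- reachability in `H` is reachability of the roots in `y`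
    have hH : ∀ a b, H.Reachable (x.graph.connectedComponentMk a) (x.graph.connectedComponentMk b)
        ↔ y.graph.Reachable a b := by
      intro a b
      constructor
      · intro h
        have h1 := reachable_of_adj_or_eq (H := y.graph) x.root (fun c d hcd => Or.inl hcd) h
        exact ((x.reachable_root a).mono hg).trans (h1.trans ((x.reachable_root b).mono hg).symm)
      · refine reachable_of_adj_or_eq x.graph.connectedComponentMk (fun p q hpq => ?_)
        rcases he p q hpq with h1 | ⟨hp, hq⟩
        · exact Or.inr (SimpleGraph.ConnectedComponent.eq.2 h1.reachable)
        · left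
          change y.graph.Adj _ _
          rwa [x.root_mk_of_mem hp, x.root_mk_of_mem hq]
    let θ : RootedForest x.Block :=
      { graph := H
        roots := x.root ⁻¹' y.roots
        acyclic := y.acyclic.comap (⟨x.root, fun h => h⟩ : H →g y.graph) x.root_injective
        existsUnique_root := by
          intro C
          induction C using SimpleGraph.ConnectedComponent.ind with
          | _ c =>
          induction c using SimpleGraph.ConnectedComponent.ind with
          | _ v =>
          set r := y.root (y.graph.connectedComponentMk v) with hrdef
          have hry : r ∈ y.roots := y.root_mem _
          refine ⟨x.graph.connectedComponentMk r, ⟨?_, ?_⟩, ?_⟩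
          · rw [SimpleGraph.ConnectedComponent.eq, hH]
            exact (y.reachable_root v).symm
          · change x.root _ ∈ y.roots
            rwa [x.root_mk_of_mem (hr hry)]
          · rintro d ⟨h, hd⟩
            change x.root d ∈ y.roots at hd
            rw [← x.mk_root d, SimpleGraph.ConnectedComponent.eq, hH] at h
            rw [← x.mk_root d,
              y.eq_of_roots_of_reachable hd hry (h.trans (y.reachable_root v))] }
    refine ⟨θ, RootedForest.ext ?_ ?_⟩
    · ext a b
      change (x.compGraph θ).Adj a b ↔ _
      rw [compGraph_adj]
      constructor
      · rintro (h | ⟨c, d, h, rfl, rfl⟩)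
        · exact hg h
        · exact h
      · intro h
        rcases he a b h with h1 | ⟨ha, hb⟩
        · exact Or.inl h1
        · refine Or.inr ⟨_, _, ?_, x.root_mk_of_mem ha, x.root_mk_of_mem hb⟩
          change y.graph.Adj _ _
          rwa [x.root_mk_of_mem ha, x.root_mk_of_mem hb]
    · change x.root '' (x.root ⁻¹' y.roots) = y.roots
      refine Set.image_preimage_eq_of_subset fun r h => ?_
      exact ⟨_, x.root_mk_of_mem (hr h)⟩

/-- The poset `Π_NAP(I)`. -/
instance : PartialOrder (RootedForest I) where
  le_refl x := le_iff.2 ⟨le_rfl, subset_rfl, fun _ _ h => Or.inl h⟩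
  le_trans x y z hxy hyz := by
    rw [le_iff] at *
    obtain ⟨h1, h2, h3⟩ := hxy
    obtain ⟨k1, k2, k3⟩ := hyz
    refine ⟨h1.trans k1, k2.trans h2, fun a b h => ?_⟩
    rcases k3 a b h with h | ⟨ha, hb⟩
    · exact h3 a b h
    · exact Or.inr ⟨h2 ha, h2 hb⟩
  le_antisymm x y hxy hyx := by
    rw [le_iff] at *
    exact RootedForest.ext (le_antisymm hxy.1 hyx.1) (subset_antisymm hyx.2.1 hxy.2.1)

end RootedForest

/-! ### Reduced homology of the order complex and Cohen-Macaulay posets -/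

section OrderComplex

variable (k : Type v) [CommRing k] (P : Type w) [PartialOrder P]

/-- The free `k`-module on the chains `s 0 < s 1 < ⋯ < s (m - 1)` with `m` elements in the poset
`P`, that is, on the simplices of dimension `m - 1` of the order complex of `P`.  For `m = 0` there
is exactly one such chain, the empty simplex. -/
abbrev OrderChains (m : ℕ) : Type (max v w) := (Fin m ↪o P) →₀ k

/-- The boundary map of the augmented simplicial chain complex of the order complex of `P`:
`∂ (s 0 < ⋯ < s m) = ∑ i, (-1) ^ i (s 0 < ⋯ < s i omitted < ⋯ < s m)`. -/
noncomputable def orderBoundary (m : ℕ) : OrderChains k P (m + 1) →ₗ[k] OrderChains k P m :=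
  Finsupp.linearCombination k fun s : Fin (m + 1) ↪o P =>
    ∑ i : Fin (m + 1), (-1 : k) ^ (i : ℕ) •
      Finsupp.single ((Fin.succAboveOrderEmb i).trans s) (1 : k)

/-- The cycles of dimension `m - 1`. -/
noncomputable def reducedCycles : (m : ℕ) → Submodule k (OrderChains k P m)
  | 0 => ⊤
  | m + 1 => LinearMap.ker (orderBoundary k P m)

/-- The boundaries of dimension `m - 1`. -/
noncomputable def reducedBoundaries (m : ℕ) : Submodule k (OrderChains k P m) :=
  LinearMap.range (orderBoundary k P m)

/-- The composite of two boundary maps is zero. -/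
theorem orderBoundary_comp (m : ℕ) :
    orderBoundary k P m ∘ₗ orderBoundary k P (m + 1) = 0 := by
  refine Finsupp.lhom_ext' fun s => LinearMap.ext_ring ?_
  simp only [LinearMap.comp_apply, Finsupp.lsingle_apply, orderBoundary, LinearMap.zero_apply,
    Finsupp.linearCombination_single, map_sum, map_smul, Finset.smul_sum, smul_smul]
  rw [← Finset.sum_product']
  refine Finset.sum_involution (fun p _ => (p.1.succAbove p.2, p.2.predAbove p.1)) ?_ ?_ ?_ ?_
  · rintro ⟨i, j⟩ -
    have e : (Fin.succAboveOrderEmb (j.predAbove i)).trans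
          ((Fin.succAboveOrderEmb (i.succAbove j)).trans s) =
        (Fin.succAboveOrderEmb j).trans ((Fin.succAboveOrderEmb i).trans s) := by
      ext a
      exact congrArg s (Fin.succAbove_succAbove_succAbove_predAbove i j a)
    dsimp only
    simp only [one_mul]
    rw [e, ← add_smul, ← pow_add, ← pow_add, Fin.neg_one_pow_succAbove_add_predAbove,
      add_neg_cancel, zero_smul]
  · rintro ⟨i, j⟩ - - he
    exact Fin.succAbove_ne i j (congrArg Prod.fst he)
  · intros
    simp
  · rintro ⟨i, j⟩ -
    simp [Fin.succAbove_succAbove_predAbove, Fin.predAbove_predAbove_succAbove]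

/-- The boundaries are cycles. -/
theorem reducedBoundaries_le_reducedCycles (m : ℕ) :
    reducedBoundaries k P m ≤ reducedCycles k P m := by
  cases m with
  | zero => exact le_top
  | succ m => exact LinearMap.range_le_ker_iff.2 (orderBoundary_comp k P m)

/-- The reduced homology `H̃_{m - 1}(Δ(P); k)` of the order complex of the poset `P` vanishes: every
cycle of dimension `m - 1` is a boundary. -/
def ReducedHomologyVanishes (m : ℕ) : Prop :=
  reducedCycles k P m = reducedBoundaries k P m

/-- A poset is Cohen-Macaulay over `k` if it is finite, bounded and pure (all its maximal chains
have the same number of elements) and, for all `x < y`, the reduced homology over `k` of the order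
complex of the open interval `(x, y)` vanishes in every degree other than the top degree `ℓ - 2`,
where `ℓ` is the length of the closed interval `[x, y]`.  Below, `m` stands for the degree
plus one. -/
structure IsCohenMacaulayPoset : Prop where
  finite : Finite P
  exists_bot : ∃ b : P, ∀ x, b ≤ x
  exists_top : ∃ t : P, ∀ x, x ≤ t
  pure : ∀ s t : Flag P, (s : Set P).ncard = (t : Set P).ncard
  homology : ∀ x y : P, x < y → ∀ m : ℕ,
    ((m + 1 : ℕ) : WithBot ℕ∞) ≠ Order.krullDim (Set.Icc x y) →
      ReducedHomologyVanishes k (Set.Ioo x y) m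

end OrderComplex

/-! A forest `x ≤ b` is obtained from `b` by deleting the edges that join two roots of `x`, so it is
determined by its set of roots, and the order below `b` is reverse inclusion of root sets
(`le_iff_roots_subset`). The sets that occur are those containing the roots of `b` and, with each
vertex, its path to the root of its tree in `b` (`isRootClosed_roots`,
`IsRootClosed.exists_roots_eq`). This condition is stable under union and intersection, and `a ≤ x`
means that the roots of `x` lie among those of `a`. Hence `[a, b]` is a finite distributive lattice.

For such a lattice, modularity gives a rank function, hence purity and the lengths of intervals. For
the homology of `(x, y)` (`vanishesOn_Ioo`), let `a` be an atom of `[x, y]` with `a ≠ y`. The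
elements `z` with `z ⊔ a ≠ y` form an acyclic poset, because `z ≤ z ⊔ a ≥ a`. The others are
complements of `a`; by distributivity there is at most one, say `c`, and it is a coatom. Adding `c`
glues a cone over `(x, c)`, so the homology of `(x, y)` vanishes in a given degree as soon as that
of `(x, c)` vanishes one degree lower, and induction on `y` concludes. -/

/-! ### Homology of subsets of a poset, computed inside one ambient chain complex. -/

section Homology

variable (k : Type v) [CommRing k] {P : Type w} [PartialOrder P]

/-- The chains of the order complex of the subset `S` of `P`, as chains of `P`. -/
def chainsIn (S : Set P) (m : ℕ) : Submodule k (OrderChains k P m) :=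
  Finsupp.supported k k {s : Fin m ↪o P | ∀ i, s i ∈ S}

/-- The reduced homology of the order complex of the subset `S` vanishes in degree `m - 1`. -/
def VanishesOn (S : Set P) (m : ℕ) : Prop :=
  ∀ z ∈ chainsIn k S m, z ∈ reducedCycles k P m →
    ∃ u ∈ chainsIn k S (m + 1), orderBoundary k P m u = z

variable {k}

theorem single_mem_chainsIn {S : Set P} {m : ℕ} {s : Fin m ↪o P} (hs : ∀ i, s i ∈ S) (r : k) :
    Finsupp.single s r ∈ chainsIn k S m :=
  Finsupp.single_mem_supported k r hs

theorem chainsIn_mono {S T : Set P} (h : S ⊆ T) (m : ℕ) : chainsIn k S m ≤ chainsIn k T m :=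
  Finsupp.supported_mono fun _ hs i => h (hs i)

/-- A submodule contains the chains of `S` as soon as it contains the simplices of `S`. -/
theorem chainsIn_le {S : Set P} {m : ℕ} {N : Submodule k (OrderChains k P m)}
    (h : ∀ s : Fin m ↪o P, (∀ i, s i ∈ S) → Finsupp.single s (1 : k) ∈ N) :
    chainsIn k S m ≤ N := by
  rw [chainsIn, Finsupp.supported_eq_span_single, Submodule.span_le]
  rintro _ ⟨s, hs, rfl⟩
  exact h s hs

/-- Two linear maps which agree on the simplices of `S` agree on the chains of `S`. -/
theorem eqOn_chainsIn {M : Type*} [AddCommGroup M] [Module k M] {S : Set P} {m : ℕ}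
    {f g : OrderChains k P m →ₗ[k] M}
    (h : ∀ s : Fin m ↪o P, (∀ i, s i ∈ S) →
      f (Finsupp.single s (1 : k)) = g (Finsupp.single s (1 : k)))
    {z : OrderChains k P m} (hz : z ∈ chainsIn k S m) : f z = g z :=
  chainsIn_le (N := LinearMap.eqLocus f g) h hz

theorem orderBoundary_single {m : ℕ} (s : Fin (m + 1) ↪o P) :
    orderBoundary k P m (Finsupp.single s (1 : k)) =
      ∑ i : Fin (m + 1), (-1 : k) ^ (i : ℕ) •
        Finsupp.single ((Fin.succAboveOrderEmb i).trans s) (1 : k) := by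
  simp [orderBoundary]

theorem orderBoundary_mem_chainsIn {S : Set P} {m : ℕ} {z : OrderChains k P (m + 1)}
    (hz : z ∈ chainsIn k S (m + 1)) : orderBoundary k P m z ∈ chainsIn k S m := by
  refine chainsIn_le (N := (chainsIn k S m).comap (orderBoundary k P m)) (fun s hs => ?_) hz
  rw [Submodule.mem_comap, orderBoundary_single]
  exact Submodule.sum_mem _ fun i _ => Submodule.smul_mem _ _ 
    (single_mem_chainsIn (fun j => hs ((Fin.succAboveOrderEmb i) j)) _)

/-- The chain obtained by adding the element `c` below the chain `s`. -/
def chainCons (c : P) {m : ℕ} (s : Fin m ↪o P) (h : ∀ i, c < s i) : Fin (m + 1) ↪o P :=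
  OrderEmbedding.ofStrictMono (Fin.cons c s : Fin (m + 1) → P) (by
    intro i j hij
    induction i using Fin.cases with
    | zero =>
      induction j using Fin.cases with
      | zero => exact absurd hij (lt_irrefl _)
      | succ j => simpa using h j
    | succ i =>
      induction j using Fin.cases with
      | zero => exact absurd hij (Fin.not_lt_zero _)
      | succ j => simpa using hij)

@[simp] theorem chainCons_zero (c : P) {m : ℕ} (s : Fin m ↪o P) (h : ∀ i, c < s i) :
    chainCons c s h 0 = c := rfl

@[simp] theorem chainCons_succ (c : P) {m : ℕ} (s : Fin m ↪o P) (h : ∀ i, c < s i) (i : Fin m) :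
    chainCons c s h i.succ = s i := rfl

open Classical in
variable (k) in
/-- The cone operator, which adds the element `c` below the chains lying above `c`. -/
noncomputable def coneMap (c : P) (m : ℕ) : OrderChains k P m →ₗ[k] OrderChains k P (m + 1) :=
  Finsupp.linearCombination k fun s =>
    if h : ∀ i, c < s i then Finsupp.single (chainCons c s h) (1 : k) else 0

open Classical in
variable (k) in
/-- The operator which removes the least element of the chains beginning with `c` and kills the
other chains. -/
noncomputable def tailMap (c : P) (m : ℕ) : OrderChains k P (m + 1) →ₗ[k] OrderChains k P m :=
  Finsupp.linearCombination k fun s =>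
    if s 0 = c then Finsupp.single ((Fin.succAboveOrderEmb 0).trans s) (1 : k) else 0

theorem coneMap_single {c : P} {m : ℕ} {s : Fin m ↪o P} (h : ∀ i, c < s i) :
    coneMap k c m (Finsupp.single s (1 : k)) = Finsupp.single (chainCons c s h) (1 : k) := by
  simp [coneMap, h]

theorem tailMap_single {c : P} {m : ℕ} {s : Fin (m + 1) ↪o P} (h : s 0 = c) :
    tailMap k c m (Finsupp.single s (1 : k)) =
      Finsupp.single ((Fin.succAboveOrderEmb 0).trans s) (1 : k) := by
  simp [tailMap, h]

theorem tailMap_eq_zero {c : P} {A : Set P} (hA : c ∉ A) {m : ℕ} {z : OrderChains k P (m + 1)}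
    (hz : z ∈ chainsIn k A (m + 1)) : tailMap k c m z = 0 := by
  refine eqOn_chainsIn (g := 0) (fun s hs => ?_) hz
  have : s 0 ≠ c := fun h => hA (h ▸ hs 0)
  simp [tailMap, this]

theorem tail_chainCons {c : P} {m : ℕ} (s : Fin m ↪o P) (h : ∀ i, c < s i) :
    (Fin.succAboveOrderEmb 0).trans (chainCons c s h) = s := by
  ext i
  simp

theorem tailMap_coneMap {c : P} {B : Set P} (hB : ∀ b ∈ B, c < b) {m : ℕ}
    {w : OrderChains k P m} (hw : w ∈ chainsIn k B m) :
    tailMap k c m (coneMap k c m w) = w := by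
  refine eqOn_chainsIn (f := tailMap k c m ∘ₗ coneMap k c m) (g := LinearMap.id) (fun s hs => ?_) hw
  have h : ∀ i, c < s i := fun i => hB _ (hs i)
  rw [LinearMap.comp_apply, coneMap_single h, tailMap_single (chainCons_zero c s h),
    tail_chainCons, LinearMap.id_apply]

theorem coneMap_mem_chainsIn {c : P} {B S : Set P} (hB : ∀ b ∈ B, c < b) (hBS : B ⊆ S)
    (hc : c ∈ S) {m : ℕ} {w : OrderChains k P m} (hw : w ∈ chainsIn k B m) :
    coneMap k c m w ∈ chainsIn k S (m + 1) := by
  refine chainsIn_le (N := (chainsIn k S (m + 1)).comap (coneMap k c m)) (fun s hs => ?_) hw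
  rw [Submodule.mem_comap, coneMap_single fun i => hB _ (hs i)]
  refine single_mem_chainsIn (fun i => ?_) _
  induction i using Fin.cases with
  | zero => exact hc
  | succ i => exact hBS (hs i)

theorem orderBoundary_coneMap_zero {c : P} (w : OrderChains k P 0) :
    orderBoundary k P 0 (coneMap k c 0 w) = w := by
  refine LinearMap.congr_fun (f := orderBoundary k P 0 ∘ₗ coneMap k c 0) (g := LinearMap.id)
    (Finsupp.lhom_ext' fun s => LinearMap.ext_ring ?_) w
  have h : ∀ i, c < s i := fun i => i.elim0
  simp only [LinearMap.comp_apply, Finsupp.lsingle_apply, LinearMap.id_apply]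
  rw [coneMap_single h, orderBoundary_single]
  simp [tail_chainCons]

/-- Deleting the apex gives back `w`; deleting any other vertex gives a cone over a face of `w`,
whose index is shifted by one, whence the minus sign. -/
theorem orderBoundary_coneMap {c : P} {B : Set P} (hB : ∀ b ∈ B, c < b) {m : ℕ}
    {w : OrderChains k P (m + 1)} (hw : w ∈ chainsIn k B (m + 1)) :
    orderBoundary k P (m + 1) (coneMap k c (m + 1) w) =
      w - coneMap k c m (orderBoundary k P m w) := by
  refine eqOn_chainsIn (f := orderBoundary k P (m + 1) ∘ₗ coneMap k c (m + 1))
    (g := LinearMap.id - coneMap k c m ∘ₗ orderBoundary k P m) (fun s hs => ?_) hw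
  have h : ∀ i, c < s i := fun i => hB _ (hs i)
  simp only [LinearMap.comp_apply, LinearMap.sub_apply, LinearMap.id_apply]
  rw [coneMap_single h, orderBoundary_single, orderBoundary_single, Fin.sum_univ_succ,
    tail_chainCons, map_sum, sub_eq_add_neg, ← Finset.sum_neg_distrib]
  simp only [Fin.val_zero, pow_zero, one_smul, map_smul]
  congr 1
  refine Finset.sum_congr rfl fun i _ => ?_
  rw [coneMap_single (s := (Fin.succAboveOrderEmb i).trans s) (fun j => h _), Fin.val_succ,
    pow_succ, mul_neg_one, neg_smul]
  congr 3
  ext j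
  induction j using Fin.cases with
  | zero => rfl
  | succ j =>
    change chainCons c s h (i.succ.succAbove j.succ) = s (i.succAbove j)
    rw [Fin.succ_succAbove_succ, chainCons_succ]

/-- The cone over a cycle. -/
theorem orderBoundary_coneMap_of_cycle {c : P} {B : Set P} (hB : ∀ b ∈ B, c < b) {m : ℕ}
    {w : OrderChains k P m} (hw : w ∈ chainsIn k B m) (hw' : w ∈ reducedCycles k P m) :
    orderBoundary k P m (coneMap k c m w) = w := by
  cases m with
  | zero => exact orderBoundary_coneMap_zero w
  | succ m =>
    rw [orderBoundary_coneMap hB hw, LinearMap.mem_ker.1 hw', map_zero, sub_zero]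

/-- Decomposition of the chains of `S` when `c` is a minimal element of `S`. -/
theorem exists_add_coneMap {c : P} {A B S : Set P} (hA : ∀ s ∈ S, s ≠ c → s ∈ A)
    (hB : ∀ s ∈ S, c < s → s ∈ B) (hmin : ∀ s ∈ S, ¬ s < c) {m : ℕ}
    {z : OrderChains k P (m + 1)} (hz : z ∈ chainsIn k S (m + 1)) :
    ∃ y ∈ chainsIn k A (m + 1), ∃ w ∈ chainsIn k B m, z = y + coneMap k c m w := by
  have key : chainsIn k S (m + 1) ≤
      chainsIn k A (m + 1) ⊔ (chainsIn k B m).map (coneMap k c m) := by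
    refine chainsIn_le fun s hs => ?_
    by_cases h0 : s 0 = c
    · have h : ∀ i, c < ((Fin.succAboveOrderEmb 0).trans s) i := fun i => by
        rw [← h0]; simp
      refine Submodule.mem_sup_right ⟨Finsupp.single ((Fin.succAboveOrderEmb 0).trans s) (1 : k),
        single_mem_chainsIn (fun i : Fin m => hB _ (hs _) (h i)) (1 : k), ?_⟩
      rw [coneMap_single h]
      congr 1
      ext i
      induction i using Fin.cases with
      | zero => exact h0.symm
      | succ i => simp
    -- By minimality `c` can only occur as the first vertex, so a chain not starting at `c` avoids
    -- it.
    · refine Submodule.mem_sup_left (single_mem_chainsIn (fun i => hA _ (hs i) fun h => ?_) 1)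
      rcases (Fin.zero_le i).eq_or_lt with hi | hi
      · exact h0 (hi ▸ h)
      · exact hmin _ (hs 0) (h ▸ s.strictMono hi)
  obtain ⟨y, hy, _, ⟨w, hw, rfl⟩, h⟩ := Submodule.mem_sup.1 (key hz)
  exact ⟨y, hy, w, hw, h.symm⟩

/-- In `∂y + w - c * ∂w = 0` only the last term involves chains starting at `c`; `tailMap` isolates
it and gives `∂w = 0`, after which the rest reads `∂y + w = 0`. -/
theorem cycle_of_add_coneMap {c : P} {A B : Set P} (hA : c ∉ A) (hB : ∀ b ∈ B, c < b) {m : ℕ}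
    {y : OrderChains k P (m + 1)} (hy : y ∈ chainsIn k A (m + 1)) {w : OrderChains k P m}
    (hw : w ∈ chainsIn k B m) (h : orderBoundary k P m (y + coneMap k c m w) = 0) :
    w ∈ reducedCycles k P m ∧ orderBoundary k P m y + w = 0 := by
  have hw' : w ∈ reducedCycles k P m := by
    cases m with
    | zero => trivial
    | succ m =>
      rw [map_add, orderBoundary_coneMap hB hw] at h
      have h1 := congrArg (tailMap k c m) h
      have hcB : c ∉ B := fun hc => (hB c hc).false
      rw [map_add, map_sub, tailMap_eq_zero hA (orderBoundary_mem_chainsIn hy),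
        tailMap_eq_zero hcB hw, tailMap_coneMap hB (orderBoundary_mem_chainsIn hw)] at h1
      simpa [reducedCycles] using h1
  refine ⟨hw', ?_⟩
  rwa [map_add, orderBoundary_coneMap_of_cycle hB hw hw'] at h

theorem vanishesOn_zero {S : Set P} (hS : S.Nonempty) : VanishesOn k S 0 := by
  obtain ⟨c, hc⟩ := hS
  intro z _ _
  refine ⟨coneMap k c 0 z, ?_, orderBoundary_coneMap_zero z⟩
  refine chainsIn_le (S := S) (N := (chainsIn k S 1).comap (coneMap k c 0)) (fun s hs => ?_) ‹_›
  rw [Submodule.mem_comap, coneMap_single fun i => i.elim0]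
  refine single_mem_chainsIn (fun i => ?_) _
  rw [Subsingleton.elim i 0]
  exact hc

/-- Index `0` is left out: the empty simplex is a cycle, and in the empty poset it bounds nothing
unless `k` is trivial. -/
theorem vanishesOn_empty (m : ℕ) : VanishesOn k (∅ : Set P) (m + 1) := by
  intro z hz _
  refine ⟨0, zero_mem _, ?_⟩
  rw [map_zero]
  exact (chainsIn_le (N := ⊥) (fun s hs => (hs 0).elim) hz : z ∈ (⊥ : Submodule k _)).symm

/-- A poset with a least element is acyclic. -/
theorem vanishesOn_of_isLeast {c : P} {S : Set P} (hc : IsLeast S c) (m : ℕ) :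
    VanishesOn k S m := by
  cases m with
  | zero => exact vanishesOn_zero ⟨c, hc.1⟩
  | succ m =>
    intro z hz hz'
    have hlt : ∀ s ∈ S \ {c}, c < s := fun s hs => (hc.2 hs.1).lt_of_ne' hs.2
    obtain ⟨y, hy, w, hw, rfl⟩ := exists_add_coneMap (c := c) (A := S \ {c}) (B := S \ {c})
      (fun s hs h => ⟨hs, h⟩) (fun s hs h => ⟨hs, h.ne'⟩) (fun s hs => (hc.2 hs).not_gt) hz
    obtain ⟨-, h2⟩ := cycle_of_add_coneMap (fun h => h.2 rfl) hlt hy hw (LinearMap.mem_ker.1 hz')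
    -- Since `∂y = -w`, the cone over `y` has boundary `y - c * ∂y = y + c * w`.
    refine ⟨coneMap k c _ y, coneMap_mem_chainsIn hlt Set.sdiff_subset hc.1 hy, ?_⟩
    rw [orderBoundary_coneMap hlt hy, eq_neg_of_add_eq_zero_left h2, map_neg, sub_neg_eq_add]

/-- Adding a minimal element `c` to a poset. -/
theorem vanishesOn_of_minimal {c : P} {S : Set P} (hc : c ∈ S) (hmin : ∀ s ∈ S, ¬ s < c) {m : ℕ}
    (h1 : VanishesOn k (S \ {c}) (m + 1)) (h2 : VanishesOn k {s ∈ S | c < s} m) :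
    VanishesOn k S (m + 1) := by
  intro z hz hz'
  have hlt : ∀ s ∈ {s ∈ S | c < s}, c < s := fun s hs => hs.2
  obtain ⟨y, hy, w, hw, rfl⟩ := exists_add_coneMap (c := c) (A := S \ {c}) (B := {s ∈ S | c < s})
    (fun s hs h => ⟨hs, h⟩) (fun s hs h => ⟨hs, h⟩) hmin hz
  obtain ⟨hw', hyw⟩ :=
    cycle_of_add_coneMap (fun h => h.2 rfl) hlt hy hw (LinearMap.mem_ker.1 hz')
  -- With `w = ∂u`, the cycle `y + c * w` equals `(y + u) - ∂(c * u)`, and `y + u` is a cycle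
  -- avoiding `c`, to which `h1` applies.
  obtain ⟨u, hu, rfl⟩ := h2 w hw hw'
  have hu' : u ∈ chainsIn k (S \ {c}) (m + 1) := 
    chainsIn_mono (show {s ∈ S | c < s} ⊆ S \ {c} from fun s hs => ⟨hs.1, hs.2.ne'⟩) _ hu
  obtain ⟨t, ht, ht'⟩ := h1 (y + u) (add_mem hy hu') (by
    rw [reducedCycles, LinearMap.mem_ker, map_add, hyw])
  refine ⟨t - coneMap k c _ u, sub_mem (chainsIn_mono Set.sdiff_subset _ ht)
    (coneMap_mem_chainsIn hlt (fun s hs => hs.1) hc hu), ?_⟩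
  rw [map_sub, ht', orderBoundary_coneMap hlt hu]
  abel

/-! ### Order reversal, which turns statements about minimal elements into ones about maximal
elements. -/

section Antitone

variable {Q : Type*} [PartialOrder Q] {f : P → Q} {g : Q → P}

/-- The image of a chain under a strictly antitone map. -/
def chainRev (hf : StrictAnti f) {m : ℕ} (s : Fin m ↪o P) : Fin m ↪o Q :=
  OrderEmbedding.ofStrictMono (fun i => f (s i.rev))
    fun _ _ h => hf (s.strictMono (Fin.rev_lt_rev.2 h))

variable (k) in
/-- The map induced on chains by a strictly antitone map. -/
noncomputable def revMap (hf : StrictAnti f) (m : ℕ) : OrderChains k P m →ₗ[k] OrderChains k Q m :=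
  Finsupp.lmapDomain k k (chainRev hf)

theorem revMap_single (hf : StrictAnti f) {m : ℕ} (s : Fin m ↪o P) (r : k) :
    revMap k hf m (Finsupp.single s r) = Finsupp.single (chainRev hf s) r := by
  simp [revMap]

theorem revMap_revMap (hf : StrictAnti f) (hg : StrictAnti g) (hgf : Function.LeftInverse g f)
    {m : ℕ} (z : OrderChains k P m) : revMap k hg m (revMap k hf m z) = z := by
  refine LinearMap.congr_fun (f := revMap k hg m ∘ₗ revMap k hf m) (g := LinearMap.id)
    (Finsupp.lhom_ext' fun s => LinearMap.ext_ring ?_) z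
  simp only [LinearMap.comp_apply, Finsupp.lsingle_apply, LinearMap.id_apply]
  rw [revMap_single, revMap_single]
  congr 1
  ext i
  change g (f (s i.rev.rev)) = s i
  rw [Fin.rev_rev, hgf]

/-- Reversal exchanges the faces `i` and `m - i`, whose signs differ by `(-1) ^ m`. -/
theorem orderBoundary_revMap (hf : StrictAnti f) {m : ℕ} (z : OrderChains k P (m + 1)) :
    orderBoundary k Q m (revMap k hf (m + 1) z) =
      (-1 : k) ^ m • revMap k hf m (orderBoundary k P m z) := by
  refine LinearMap.congr_fun (f := orderBoundary k Q m ∘ₗ revMap k hf (m + 1))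
    (g := (-1 : k) ^ m • (revMap k hf m ∘ₗ orderBoundary k P m))
    (Finsupp.lhom_ext' fun s => LinearMap.ext_ring ?_) z
  simp only [LinearMap.comp_apply, Finsupp.lsingle_apply, LinearMap.smul_apply]
  rw [revMap_single, orderBoundary_single, orderBoundary_single, map_sum, Finset.smul_sum]
  refine Fintype.sum_equiv Fin.revPerm _ _ fun i => ?_
  rw [map_smul, revMap_single, smul_smul, ← pow_add, Fin.revPerm_apply]
  congr 1
  · have hi : m + (i.rev : ℕ) = i + 2 * i.rev := by rw [Fin.val_rev]; omega
    rw [hi, pow_add, pow_mul]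
    simp
  · congr 1
    ext j
    change f (s (i.succAbove j).rev) = f (s (i.rev.succAbove j.rev))
    rw [Fin.rev_succAbove]

theorem revMap_mem_chainsIn (hf : StrictAnti f) {S : Set P} {T : Set Q} (hST : Set.MapsTo f S T)
    {m : ℕ} {z : OrderChains k P m} (hz : z ∈ chainsIn k S m) :
    revMap k hf m z ∈ chainsIn k T m := by
  refine chainsIn_le (N := (chainsIn k T m).comap (revMap k hf m)) (fun s hs => ?_) hz
  rw [Submodule.mem_comap, revMap_single]
  exact single_mem_chainsIn (fun i => hST (hs _)) _

theorem revMap_mem_reducedCycles (hf : StrictAnti f) {m : ℕ} {z : OrderChains k P m}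
    (hz : z ∈ reducedCycles k P m) : revMap k hf m z ∈ reducedCycles k Q m := by
  cases m with
  | zero => trivial
  | succ m =>
    rw [reducedCycles, LinearMap.mem_ker, orderBoundary_revMap, LinearMap.mem_ker.1 hz, map_zero,
      smul_zero]

/-- Vanishing of homology is invariant under antitone bijections. -/
theorem VanishesOn.of_antitone (hf : StrictAnti f) (hg : StrictAnti g)
    (hgf : Function.LeftInverse g f) {S : Set P} {m : ℕ} (h : VanishesOn k (g ⁻¹' S) m) :
    VanishesOn k S m := by
  intro z hz hz'
  have hS : Set.MapsTo f S (g ⁻¹' S) := fun s hs => by rwa [Set.mem_preimage, hgf]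
  obtain ⟨u, hu, huz⟩ := h _ (revMap_mem_chainsIn hf hS hz) (revMap_mem_reducedCycles hf hz')
  refine ⟨(-1 : k) ^ m • revMap k hg (m + 1) u,
    Submodule.smul_mem _ _ (revMap_mem_chainsIn hg (fun _ ht => ht) hu), ?_⟩
  rw [map_smul, orderBoundary_revMap, huz, revMap_revMap hf hg hgf, smul_smul, ← mul_pow]
  simp

end Antitone

/-- Adding a maximal element `c` to a poset. -/
theorem vanishesOn_of_maximal {c : P} {S : Set P} (hc : c ∈ S) (hmax : ∀ s ∈ S, ¬ c < s) {m : ℕ}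
    (h1 : VanishesOn k (S \ {c}) (m + 1)) (h2 : VanishesOn k {s ∈ S | s < c} m) :
    VanishesOn k S (m + 1) := by
  have hto : StrictAnti (OrderDual.toDual : P → Pᵒᵈ) := fun _ _ h => h
  have hof : StrictAnti (OrderDual.ofDual : Pᵒᵈ → P) := fun _ _ h => h
  refine VanishesOn.of_antitone hto hof (fun _ => rfl)
    (vanishesOn_of_minimal (c := OrderDual.toDual c) hc (fun s hs => hmax _ hs) ?_ ?_)
  · exact VanishesOn.of_antitone hof hto (fun _ => rfl) h1
  · exact VanishesOn.of_antitone hof hto (fun _ => rfl) h2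

/-- A finite poset `S` which retracts onto a cone by a monotone map `f` with `s ≤ f s ≥ a` is
acyclic. -/
theorem vanishesOn_of_le_of_ge [Finite P] {S : Set P} {a : P} (ha : a ∈ S) {f : P → P}
    (hf : Monotone f) (hfS : ∀ s ∈ S, f s ∈ S) (hle : ∀ s ∈ S, s ≤ f s) (hge : ∀ s ∈ S, a ≤ f s)
    (m : ℕ) : VanishesOn k S m := by
  induction hn : S.ncard using Nat.strong_induction_on generalizing S a m with
  | _ n ih =>
  subst hn
  by_cases hall : ∀ s ∈ S, a ≤ s
  · exact vanishesOn_of_isLeast ⟨ha, hall⟩ m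
  cases m with
  | zero => exact vanishesOn_zero ⟨a, ha⟩
  | succ m =>
    push Not at hall
    obtain ⟨s₀, hs₀, hs₀'⟩ := hall
    -- A minimal `z` among the elements not above `a` is minimal in `S`, and it is not a value of
    -- `f` on `S`, as these values lie above `a`. So `f` still acts on `S \ {z}`, with the same `a`,
    -- and on the part above `z`, with `f z` in the role of `a`.
    obtain ⟨z, ⟨hz, hz'⟩, hzmin⟩ := Set.Finite.exists_minimal
      (Set.toFinite {s ∈ S | ¬ a ≤ s}) ⟨s₀, hs₀, hs₀'⟩
    have hmin : ∀ s ∈ S, ¬ s < z := fun s hs h =>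
      h.not_ge (hzmin ⟨hs, fun has => hz' (has.trans h.le)⟩ h.le)
    have hne : ∀ s ∈ S, f s ≠ z := fun s hs h => hz' (h ▸ hge s hs)
    refine vanishesOn_of_minimal hz hmin ?_ ?_
    · refine ih _ (Set.ncard_sdiff_singleton_lt_of_mem hz) (S := S \ {z}) (a := a)
        ⟨ha, fun h => hz' h.le⟩ (fun s hs => ⟨hfS s hs.1, hne s hs.1⟩) (fun s hs => hle s hs.1)
        (fun s hs => hge s hs.1) _ rfl
    · have hzf : z < f z := (hle z hz).lt_of_ne' (hne z hz)
      refine ih _ (Set.ncard_lt_ncard ?_) (S := {s ∈ S | z < s}) (a := f z)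
        ⟨hfS z hz, hzf⟩ (fun s hs => ⟨hfS s hs.1, hs.2.trans_le (hle s hs.1)⟩)
        (fun s hs => hle s hs.1) (fun s hs => hf hs.2.le) _ rfl
      exact ⟨fun s hs => hs.1, fun h => (h hz).2.false⟩

/-- The chains of a subset, as chains of the whole poset. -/
theorem VanishesOn.reducedHomologyVanishes {S : Set P} {m : ℕ} (h : VanishesOn k S m) :
    ReducedHomologyVanishes k S m := by
  -- The inclusion of chains is injective with image `chainsIn k S m` and commutes with the
  -- boundary, so cycles and boundaries can be carried both ways.
  let j : (m : ℕ) → OrderChains k S m →ₗ[k] OrderChains k P m := fun m =>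
    Finsupp.lmapDomain k k fun s => s.trans (OrderEmbedding.subtype (· ∈ S))
  have hj1 : ∀ {m : ℕ} (s : Fin m ↪o S) (r : k), j m (Finsupp.single s r) =
      Finsupp.single (s.trans (OrderEmbedding.subtype (· ∈ S))) r := fun s r =>
    Finsupp.mapDomain_single
  have hinj : ∀ m, Function.Injective (j m) := fun m =>
    Finsupp.mapDomain_injective fun s t hst => by
      ext i
      exact DFunLike.congr_fun hst i
  have hmem : ∀ {m : ℕ} (z : OrderChains k S m), j m z ∈ chainsIn k S m := by
    intro m z
    induction z using Finsupp.induction_linear with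
    | zero => rw [map_zero]; exact zero_mem _
    | add f g hf hg => rw [map_add]; exact add_mem hf hg
    | single s r => rw [hj1]; exact single_mem_chainsIn (fun i => (s i).2) r
  have hsurj : ∀ {m : ℕ} {z : OrderChains k P m}, z ∈ chainsIn k S m → ∃ y, j m y = z := by
    intro m z hz
    refine chainsIn_le (N := LinearMap.range (j m)) (fun s hs => ?_) hz
    refine ⟨Finsupp.single (OrderEmbedding.ofStrictMono (fun i => (⟨s i, hs i⟩ : S))
      fun _ _ hab => s.strictMono hab) 1, ?_⟩
    rw [hj1]
    congr 1
  have hcomm : ∀ {m : ℕ} (z : OrderChains k S (m + 1)),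
      orderBoundary k P m (j (m + 1) z) = j m (orderBoundary k S m z) := by
    intro m z
    refine LinearMap.congr_fun (f := orderBoundary k P m ∘ₗ j (m + 1))
      (g := j m ∘ₗ orderBoundary k S m) (Finsupp.lhom_ext' fun s => LinearMap.ext_ring ?_) z
    simp only [LinearMap.comp_apply, Finsupp.lsingle_apply]
    rw [hj1, orderBoundary_single, orderBoundary_single, map_sum]
    refine Finset.sum_congr rfl fun i _ => ?_
    rw [map_smul, hj1]
    rfl
  refine le_antisymm (fun z hz => ?_) (reducedBoundaries_le_reducedCycles k S m)
  obtain ⟨u, hu, huz⟩ := h (j m z) (hmem z) (by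
    cases m with
    | zero => trivial
    | succ m => rw [reducedCycles, LinearMap.mem_ker, hcomm, LinearMap.mem_ker.1 hz, map_zero])
  obtain ⟨y, rfl⟩ := hsurj hu
  rw [hcomm] at huz
  exact ⟨y, hinj m huz⟩

end Homology

/-! ### Rank functions, purity and lengths of intervals. -/

section Rank

/-- In a finite modular lattice the height is a rank function. -/
theorem height_eq_of_covBy {L : Type*} [Lattice L] [IsModularLattice L] [Finite L] {x y : L}
    (h : x ⋖ y) : Order.height y = Order.height x + 1 := by
  induction y using WellFoundedLT.induction generalizing x with
  | _ y ih =>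
  refine le_antisymm ?_ (Order.height_add_one_le h.lt)
  rw [Order.height_eq_iSup_lt_height]
  refine iSup₂_le fun w hw => ?_
  obtain ⟨z, hwz, hzy⟩ := exists_le_covBy_of_lt hw
  refine add_le_add_left ((Order.height_mono hwz).trans ?_) 1
  by_cases hxz : x = z
  · rw [hxz]
  -- For two distinct elements covered by `y`, modularity makes both cover `x ⊓ z`; by induction
  -- they have the same height.
  have hsup : x ⊔ z = y := h.wcovBy.sup_eq hzy.wcovBy hxz
  rw [← hsup] at h hzy
  have h1 : x ⊓ z ⋖ x := inf_covBy_of_covBy_sup_right hzy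
  have h2 : x ⊓ z ⋖ z := inf_covBy_of_covBy_sup_left h
  rw [ih z (hsup ▸ hzy.lt) h2, ih x (hsup ▸ h.lt) h1]

/-- A finite modular lattice has a rank function. -/
theorem exists_rank (L : Type*) [Lattice L] [IsModularLattice L] [Finite L] :
    ∃ r : L → ℕ, StrictMono r ∧ ∀ x y, x ⋖ y → r y = r x + 1 := by
  have hfin : ∀ x : L, Order.height x ≠ ⊤ := fun x => by
    have := Fintype.ofFinite L
    refine ne_top_of_le_ne_top (ENat.natCast_ne_top (Fintype.card L)) (Order.height_le fun p _ => ?_)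
    have := Fintype.card_le_of_injective _ p.strictMono.injective
    rw [Fintype.card_fin] at this
    exact_mod_cast (Nat.le_succ _).trans this
  refine ⟨fun x => (Order.height x).toNat, fun x y h => ?_, fun x y h => ?_⟩
  · have := Order.height_strictMono h (hfin x).lt_top
    rw [← ENat.natCast_toNat (hfin x), ← ENat.natCast_toNat (hfin y)] at this
    exact_mod_cast this
  · have := height_eq_of_covBy h
    rw [← ENat.natCast_toNat (hfin x), ← ENat.natCast_toNat (hfin y)] at this
    exact_mod_cast this

variable {P : Type w} [PartialOrder P] [Finite P] {r : P → ℕ}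

/-- A maximal chain of a finite bounded graded poset has an element of each rank. -/
theorem ncard_flag [BoundedOrder P] (hr : StrictMono r) (hcov : ∀ x y, x ⋖ y → r y = r x + 1)
    (s : Flag P) : (s : Set P).ncard = r ⊤ + 1 - r ⊥ := by
  -- The rank is injective on a chain, so it suffices that a maximal chain skips no rank.
  have himg : r '' (s : Set P) = Set.Icc (r ⊥) (r ⊤) := by
    ext n
    constructor
    · rintro ⟨x, -, rfl⟩
      exact ⟨hr.monotone bot_le, hr.monotone le_top⟩
    · rintro ⟨h1, h2⟩
      induction n, h1 using Nat.le_induction with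
      | base => exact ⟨⊥, s.bot_mem, rfl⟩
      | succ n hn ih =>
        obtain ⟨x, hx, rfl⟩ := ih (by omega)
        have hne : ({y ∈ (s : Set P) | x < y}).Nonempty :=
          ⟨⊤, s.top_mem, lt_top_iff_ne_top.2 fun h => by rw [h] at h2; omega⟩
        obtain ⟨y, ⟨hy, hxy⟩, hmin⟩ := Set.Finite.exists_minimal (Set.toFinite _) hne
        -- The successor `y` of `x` in the flag covers `x` in `P`: an element strictly between them
        -- would be comparable with the whole flag, hence would belong to it.
        refine ⟨y, hy, hcov x y ⟨hxy, fun z hxz hzy => ?_⟩⟩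
        have hz : z ∈ s := by
          have hch : IsChain (· ≤ ·) (insert z (s : Set P)) := by
            refine s.chain_le.insert fun t ht _ => ?_
            rcases s.le_or_le ht hx with htx | hxt
            · exact Or.inr (htx.trans hxz.le)
            · rcases hxt.eq_or_lt with rfl | hxt
              · exact Or.inr hxz.le
              · rcases s.le_or_le ht hy with hty | hyt
                · exact Or.inl (hzy.le.trans (hmin ⟨ht, hxt⟩ hty))
                · exact Or.inl (hzy.le.trans hyt)
          have h : (s : Set P) = insert z (s : Set P) := s.max_chain' hch (Set.subset_insert _ _)
          rw [← SetLike.mem_coe, h]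
          exact Set.mem_insert z _
        exact hzy.not_ge (hmin ⟨hz, hxz⟩ hzy.le)
  have hinj : Set.InjOn r (s : Set P) := fun x hx y hy hxy => by
    rcases s.le_or_le hx hy with h | h
    · exact h.eq_of_not_lt fun h' => (hr h').ne hxy
    · exact (h.eq_of_not_lt fun h' => (hr h').ne' hxy).symm
  rw [← hinj.ncard_image, himg, ← Finset.coe_Icc, Set.ncard_coe_finset, Nat.card_Icc]

/-- In a finite graded poset, an interval contains a chain of length the difference of the
ranks. -/
theorem exists_ltSeries_Icc (hcov : ∀ x y, x ⋖ y → r y = r x + 1) {x y : P} (h : x ≤ y) :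
    ∃ p : LTSeries (Set.Icc x y), p.head = ⟨x, le_rfl, h⟩ ∧ r x + p.length = r y := by
  induction x using WellFoundedGT.induction with
  | _ x ih =>
  rcases h.eq_or_lt with rfl | hlt
  · exact ⟨RelSeries.singleton _ ⟨x, le_rfl, le_rfl⟩, rfl, rfl⟩
  obtain ⟨z, hxz, hzy⟩ := exists_covBy_le_of_lt hlt
  obtain ⟨p, hp, hlen⟩ := ih z hxz.lt hzy
  let f : Set.Icc z y → Set.Icc x y := fun t => ⟨t, hxz.le.trans t.2.1, t.2.2⟩
  have hf : StrictMono f := fun _ _ hab => hab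
  refine ⟨(p.map f hf).cons ⟨x, le_rfl, h⟩ ?_, RelSeries.head_cons _ _ _, ?_⟩
  · rw [LTSeries.head_map, hp]
    exact hxz.lt
  · rw [RelSeries.cons_length, LTSeries.map_length, ← hlen, hcov x z hxz]
    ring

/-- Translates the degree condition in `IsCohenMacaulayPoset` into ranks. Strict monotonicity of `r`
bounds the length of chains, and a saturated chain attains the bound. -/
theorem krullDim_Icc (hr : StrictMono r) (hcov : ∀ x y, x ⋖ y → r y = r x + 1) {x y : P}
    (h : x ≤ y) : Order.krullDim (Set.Icc x y) = ((r y - r x : ℕ) : WithBot ℕ∞) := by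
  refine le_antisymm ?_ ?_
  · let f : Set.Icc x y → Fin (r y - r x + 1) := fun t => ⟨r t - r x, by
      have := hr.monotone t.2.2
      omega⟩
    have hf : StrictMono f := fun s t hst => by
      have h1 := hr.monotone s.2.1
      have h2 : r s < r t := hr hst
      exact Fin.lt_def.2 (by simp only [f]; omega)
    refine iSup_le fun p => ?_
    have := Fintype.card_le_of_injective _ (hf.comp p.strictMono).injective
    rw [Fintype.card_fin, Fintype.card_fin] at this
    exact_mod_cast Nat.le_of_succ_le_succ this
  · obtain ⟨p, -, hp⟩ := exists_ltSeries_Icc hcov h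
    have := Order.LTSeries.length_le_krullDim p
    rwa [show p.length = r y - r x by omega] at this

end Rank

/-! ### Finite distributive lattices are Cohen–Macaulay. -/

section Distrib

variable (k : Type v) [CommRing k] {L : Type w} [DistribLattice L] [Finite L]

/-- The open intervals of a finite distributive lattice have homology only in the top degree. -/
theorem vanishesOn_Ioo {r : L → ℕ} (hcov : ∀ x y, x ⋖ y → r y = r x + 1) {x y : L} (hxy : x < y)
    {m : ℕ} (hm : m + 1 + r x ≠ r y) : VanishesOn k (Set.Ioo x y) m := by
  induction y using WellFoundedLT.induction generalizing m with
  | _ y ih =>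
  obtain ⟨a, hxa, hay⟩ := exists_covBy_le_of_lt hxy
  rcases hay.eq_or_lt with rfl | hay
  -- Here the open interval is empty and its length is one; the top degree is `-1`, that is `m = 0`,
  -- which `hm` excludes.
  · cases m with
    | zero => exact absurd (hcov x a hxa) (by omega)
    | succ m =>
      rw [hxa.Ioo_eq]
      exact vanishesOn_empty m
  cases m with
  | zero => exact vanishesOn_zero ⟨a, hxa.lt, hay⟩
  | succ m =>
  -- an element of the interval whose join with `a` is `y` is a complement of `a`
  have hcompl : ∀ z ∈ Set.Ioo x y, z ⊔ a = y → z ⊓ a = x := fun z hz hza => by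
    refine (hxa.eq_or_eq (le_inf hz.1.le hxa.le) inf_le_right).resolve_right fun h => ?_
    rw [sup_eq_left.2 (inf_eq_right.1 h)] at hza
    exact hz.2.ne hza
  have hacyc : VanishesOn k {z ∈ Set.Ioo x y | z ⊔ a ≠ y} (m + 1) := by
    refine vanishesOn_of_le_of_ge (S := {z ∈ Set.Ioo x y | z ⊔ a ≠ y}) (a := a)
      ⟨⟨hxa.lt, hay⟩, by simpa using hay.ne⟩
      (f := fun z => z ⊔ a) (fun _ _ h => sup_le_sup_right h a) (fun s hs => ?_)
      (fun _ _ => le_sup_left) (fun _ _ => le_sup_right) _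
    refine ⟨⟨hs.1.1.trans_le le_sup_left, lt_of_le_of_ne (sup_le hs.1.2.le hay.le) hs.2⟩, ?_⟩
    simpa using hs.2
  by_cases hc : ∃ c ∈ Set.Ioo x y, c ⊔ a = y
  · obtain ⟨c, hc, hca⟩ := hc
    -- Transposing the cover `c ⊓ a = x ⋖ a` gives `c ⋖ c ⊔ a = y`.
    have hcy : c ⋖ y := by
      have h : c ⊓ a ⋖ a := by rwa [hcompl c hc hca]
      simpa [hca] using covBy_sup_of_inf_covBy_right h
    refine vanishesOn_of_maximal hc (fun s hs h => hcy.2 h hs.2) ?_ ?_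
    · convert hacyc using 1
      ext z
      refine ⟨fun hz => ⟨hz.1, fun hza => hz.2 ?_⟩, fun hz => ⟨hz.1, ?_⟩⟩
      -- This is where distributivity is essential: relative complements are unique.
      · exact eq_of_inf_eq_sup_eq (a := a) ((hcompl z hz.1 hza).trans (hcompl c hc hca).symm)
          (hza.trans hca.symm)
      · rintro rfl
        exact hz.2 hca
    · have h : {s ∈ Set.Ioo x y | s < c} = Set.Ioo x c := by
        ext s
        exact ⟨fun hs => ⟨hs.1.1, hs.2⟩, fun hs => ⟨⟨hs.1, hs.2.trans hc.2⟩, hs.2⟩⟩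
      rw [h]
      -- Both the degree and the rank of the upper end drop by one, so the excluded degree stays the
      -- top one.
      refine ih c hc.2 hc.1 fun h' => hm ?_
      rw [hcov c y hcy]
      omega
  · push Not at hc
    rwa [Set.sep_eq_self_iff_mem_true.2 hc] at hacyc

/-- Finite distributive lattices are Cohen-Macaulay. -/
theorem isCohenMacaulayPoset_of_distribLattice [BoundedOrder L] : IsCohenMacaulayPoset k L := by
  obtain ⟨r, hr, hcov⟩ := exists_rank L
  refine ⟨‹_›, ⟨⊥, fun _ => bot_le⟩, ⟨⊤, fun _ => le_top⟩, fun s t => ?_, fun x y hxy m hm => ?_⟩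
  · rw [ncard_flag hr hcov, ncard_flag hr hcov]
  · refine (vanishesOn_Ioo k hcov hxy fun h => hm ?_).reducedHomologyVanishes
    rw [krullDim_Icc hr hcov hxy.le, ← h]
    congr
    omega

/-- A finite bounded poset which embeds into a distributive lattice as a subset closed under joins
and meets is Cohen-Macaulay. -/
theorem isCohenMacaulayPoset_of_orderEmbedding {P : Type*} [PartialOrder P] [Finite P]
    [BoundedOrder P] {D : Type*} [DistribLattice D] (φ : P ↪o D)
    (hsup : ∀ x y, ∃ z, φ z = φ x ⊔ φ y) (hinf : ∀ x y, ∃ z, φ z = φ x ⊓ φ y) :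
    IsCohenMacaulayPoset k P := by
  choose sup hsup using hsup
  choose inf hinf using hinf
  let _ : DistribLattice P :=
    { (inferInstance : PartialOrder P) with
      sup := sup
      inf := inf
      le_sup_left := fun x y => φ.le_iff_le.1 (by rw [hsup]; exact le_sup_left)
      le_sup_right := fun x y => φ.le_iff_le.1 (by rw [hsup]; exact le_sup_right)
      sup_le := fun x y z hx hy => φ.le_iff_le.1 (by
        rw [hsup]; exact sup_le (φ.monotone hx) (φ.monotone hy))
      inf_le_left := fun x y => φ.le_iff_le.1 (by rw [hinf]; exact inf_le_left)
      inf_le_right := fun x y => φ.le_iff_le.1 (by rw [hinf]; exact inf_le_right)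
      le_inf := fun x y z hx hy => φ.le_iff_le.1 (by
        rw [hinf]; exact le_inf (φ.monotone hx) (φ.monotone hy))
      le_sup_inf := fun x y z => φ.le_iff_le.1 (by
        change φ (inf (sup x y) (sup x z)) ≤ φ (sup x (inf y z))
        rw [hinf, hsup, hsup, hsup, hinf]
        exact le_sup_inf) }
  exact isCohenMacaulayPoset_of_distribLattice k

end Distrib

/-! ### Forests below `b` and their sets of roots. -/

namespace RootedForest

variable {I : Type u}

/-- Below `b`, a forest is determined by its roots: one removes from `b` the edges between roots. -/
theorem adj_iff_of_le {x b : RootedForest I} (h : x ≤ b) {u v : I} :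
    x.graph.Adj u v ↔ b.graph.Adj u v ∧ ¬ (u ∈ x.roots ∧ v ∈ x.roots) := by
  obtain ⟨h1, -, h3⟩ := le_iff.1 h
  refine ⟨fun huv => ⟨h1 huv, fun hr => ?_⟩, fun huv => (h3 u v huv.1).resolve_right huv.2⟩
  exact huv.ne (x.eq_of_roots_of_reachable hr.1 hr.2 huv.reachable)

/-- Shrinking the set of roots deletes fewer edges of `b`, and every edge thus restored joins two
roots of the smaller forest `x`. -/
theorem le_iff_roots_subset {x y b : RootedForest I} (hx : x ≤ b) (hy : y ≤ b) :
    x ≤ y ↔ y.roots ⊆ x.roots := by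
  refine ⟨fun h => (le_iff.1 h).2.1, fun h => le_iff.2 ⟨fun u v huv => ?_, h, fun u v huv => ?_⟩⟩
  · rw [adj_iff_of_le hx] at huv
    exact (adj_iff_of_le hy).2 ⟨huv.1, fun hr => huv.2 ⟨h hr.1, h hr.2⟩⟩
  · exact (le_iff.1 hx).2.2 u v ((adj_iff_of_le hy).1 huv).1

/-- The set `R` contains the roots of `b` and, with each vertex, the path from this vertex to the
root of its tree. -/
def IsRootClosed (b : RootedForest I) (R : Set I) : Prop :=
  b.roots ⊆ R ∧ ∀ v ∈ R, ∀ r ∈ b.roots, ∀ p : b.graph.Walk v r, p.IsPath → ∀ w ∈ p.support, w ∈ R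

theorem IsRootClosed.union {b : RootedForest I} {R S : Set I} (hR : b.IsRootClosed R)
    (hS : b.IsRootClosed S) : b.IsRootClosed (R ∪ S) := by
  refine ⟨hR.1.trans Set.subset_union_left, ?_⟩
  rintro v (hv | hv) r hr p hp w hw
  · exact Or.inl (hR.2 v hv r hr p hp w hw)
  · exact Or.inr (hS.2 v hv r hr p hp w hw)

theorem IsRootClosed.inter {b : RootedForest I} {R S : Set I} (hR : b.IsRootClosed R)
    (hS : b.IsRootClosed S) : b.IsRootClosed (R ∩ S) :=
  ⟨Set.subset_inter hR.1 hS.1, fun v hv r hr p hp w hw =>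
    ⟨hR.2 v hv.1 r hr p hp w hw, hS.2 v hv.2 r hr p hp w hw⟩⟩

/-- A walk which ends in `R` meets `R` at a vertex which one reaches without using edges inside
`R`. -/
theorem exists_mem_support_reachable {G H : SimpleGraph I} {R : Set I}
    (h : ∀ u v, G.Adj u v → ¬ (u ∈ R ∧ v ∈ R) → H.Adj u v) {u r : I} (p : G.Walk u r)
    (hr : r ∈ R) : ∃ v ∈ p.support, v ∈ R ∧ H.Reachable u v := by
  induction p with
  | nil => exact ⟨_, by simp, hr, SimpleGraph.Reachable.refl _⟩
  | @cons u w r hadj p ih =>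
    by_cases hu : u ∈ R
    · exact ⟨u, by simp, hu, SimpleGraph.Reachable.refl _⟩
    · obtain ⟨v, hv, hvR, hwv⟩ := ih hr
      exact ⟨v, by simp [hv], hvR, (h u w hadj fun hR => hu hR.1).reachable.trans hwv⟩

/-- Suppose that the path leaves a root `u` of `x` for a vertex `t` that is not a root of `x`. The
edge `ut` survives in `x`, and the rest of the path leads within `x` from `t` to some root `s` of
`x`. Then `s = u` by uniqueness of roots, so the path would return to `u`. -/
theorem isRootClosed_roots {x b : RootedForest I} (h : x ≤ b) : b.IsRootClosed x.roots := by
  have hb : b.roots ⊆ x.roots := (le_iff.1 h).2.1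
  have hadj : ∀ u v, b.graph.Adj u v → ¬ (u ∈ x.roots ∧ v ∈ x.roots) → x.graph.Adj u v :=
    fun u v huv hr => (adj_iff_of_le h).2 ⟨huv, hr⟩
  refine ⟨hb, fun v hv r hr p hp w hw => ?_⟩
  induction p with
  | nil =>
    rw [SimpleGraph.Walk.support_nil, List.mem_singleton] at hw
    exact hw ▸ hv
  | @cons u t r hut p ih =>
    rw [SimpleGraph.Walk.support_cons, List.mem_cons] at hw
    rcases hw with rfl | hw
    · exact hv
    rw [SimpleGraph.Walk.cons_isPath_iff] at hp
    refine ih ?_ hr hp.1 hw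
    by_contra ht
    obtain ⟨s, hs, hsR, hts⟩ := exists_mem_support_reachable hadj p (hb hr)
    have hus := (hadj u t hut fun hR => ht hR.2).reachable.trans hts
    exact hp.2 (x.eq_of_roots_of_reachable hv hsR hus ▸ hs)

/-- In a forest, a path between two vertices of a root-closed set stays in this set. -/
theorem IsRootClosed.support_subset {b : RootedForest I} {R : Set I} (hR : b.IsRootClosed R)
    {u v : I} (hu : u ∈ R) (hv : v ∈ R) (p : b.graph.Walk u v) (hp : p.IsPath) :
    ∀ w ∈ p.support, w ∈ R := by
  classical
  set r := b.root (b.graph.connectedComponentMk u)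
  have hur : b.graph.Reachable u r := b.reachable_root u
  have hpath : ∀ t ∈ R, b.graph.Reachable t r → ∃ q : b.graph.Walk t r, ∀ w ∈ q.support, w ∈ R := by
    rintro t ht ⟨q⟩
    exact ⟨q.bypass, hR.2 t ht _ (b.root_mem _) _ q.bypass_isPath⟩
  obtain ⟨q₁, h₁⟩ := hpath u hu hur
  obtain ⟨q₂, h₂⟩ := hpath v hv (p.reachable.symm.trans hur)
  -- The walk from `u` to the root and on to `v` stays in `R`; shortened to a path, it is the unique
  -- path from `u` to `v`.
  let q := (q₁.append q₂.reverse).bypass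
  have hpq : p = q := congrArg Subtype.val
    ((b.acyclic.subsingleton_path u v).elim ⟨p, hp⟩ ⟨q, SimpleGraph.Walk.bypass_isPath _⟩)
  intro w hw
  rw [hpq] at hw
  have hw' := SimpleGraph.Walk.support_bypass_subset_support _ hw
  rw [SimpleGraph.Walk.mem_support_append_iff, SimpleGraph.Walk.support_reverse,
    List.mem_reverse] at hw'
  exact hw'.elim (h₁ w) (h₂ w)

/-- The forest obtained from `b` by removing the edges inside a root-closed set of vertices. -/
theorem IsRootClosed.exists_roots_eq {b : RootedForest I} {R : Set I} (hR : b.IsRootClosed R) :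
    ∃ x : RootedForest I, x ≤ b ∧ x.roots = R := by
  classical
  let G : SimpleGraph I :=
    { Adj := fun u v => b.graph.Adj u v ∧ ¬ (u ∈ R ∧ v ∈ R)
      symm := ⟨fun u v h => ⟨h.1.symm, fun hR => h.2 hR.symm⟩⟩
      loopless := ⟨fun u h => h.1.ne rfl⟩ }
  have hG : G ≤ b.graph := fun u v h => h.1
  -- A nontrivial path of `G` between vertices of `R` is a path of `b`, hence stays in `R`; but its
  -- first edge would then lie inside `R`, and `G` has no such edge.
  have huniq : ∀ u ∈ R, ∀ v ∈ R, G.Reachable u v → u = v := by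
    rintro u hu v hv ⟨p⟩
    have hp : p.bypass.IsPath := p.bypass_isPath
    generalize p.bypass = q at hp
    cases q with
    | nil => rfl
    | @cons _ w _ hadj q =>
      have hmem := hR.support_subset hu hv _ (hp.mapLe hG) w (by simp)
      exact absurd ⟨hu, hmem⟩ hadj.2
  refine ⟨⟨G, R, b.acyclic.anti hG, fun c => ?_⟩, le_iff.2 ⟨hG, hR.1, fun u v huv => ?_⟩, rfl⟩
  · induction c using SimpleGraph.ConnectedComponent.ind with
    -- The root of the component of `v` is found by walking from `v` towards its root in `b` until
    -- `R` is met.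
    | _ v =>
    obtain ⟨p⟩ := b.reachable_root v
    obtain ⟨t, -, ht, hvt⟩ := exists_mem_support_reachable (H := G) (R := R)
      (fun u v h1 h2 => ⟨h1, h2⟩) p (hR.1 (b.root_mem _))
    refine ⟨t, ⟨SimpleGraph.ConnectedComponent.eq.2 hvt.symm, ht⟩, fun s hs => ?_⟩
    exact huniq s hs.2 t ht ((SimpleGraph.ConnectedComponent.eq.1 hs.1).trans hvt)
  · by_cases h : u ∈ R ∧ v ∈ R
    · exact Or.inr h
    · exact Or.inl ⟨huv, h⟩

end RootedForest

open RootedForest in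
/-- All intervals of the poset of rooted forests are distributive lattices, hence
Cohen-Macaulay. -/
theorem isCohenMacaulayPoset_Icc (k : Type v) [CommRing k] {I : Type u} [Finite I]
    {a b : RootedForest I} (hab : a ≤ b) : IsCohenMacaulayPoset k (Set.Icc a b) := by
  have hroots : ∀ x y : Set.Icc a b, x ≤ y ↔ y.1.roots ⊆ x.1.roots := fun x y =>
    le_iff_roots_subset x.2.2 y.2.2
  -- Because of the order dual, joins of forests are intersections of root sets and meets are
  -- unions.
  let φ : Set.Icc a b ↪o (Set I)ᵒᵈ :=
    OrderEmbedding.ofMapLEIff (fun x => OrderDual.toDual x.1.roots) fun x y => (hroots x y).symm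
  have key : ∀ R : Set I, b.IsRootClosed R → R ⊆ a.roots →
      ∃ z : Set.Icc a b, φ z = OrderDual.toDual R := fun R hR hRa => by
    obtain ⟨x, hxb, rfl⟩ := hR.exists_roots_eq
    exact ⟨⟨x, (le_iff_roots_subset hab hxb).2 hRa, hxb⟩, rfl⟩
  have hsub : ∀ x : Set.Icc a b, x.1.roots ⊆ a.roots := fun x => (le_iff.1 x.2.1).2.1
  have : Finite (Set.Icc a b) := Finite.of_injective φ φ.injective
  let _ : BoundedOrder (Set.Icc a b) :=
    { top := ⟨b, hab, le_rfl⟩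
      bot := ⟨a, le_rfl, hab⟩
      le_top := fun x => x.2.2
      bot_le := fun x => x.2.1 }
  refine isCohenMacaulayPoset_of_orderEmbedding k φ (fun x y => ?_) fun x y => ?_
  · exact key (x.1.roots ∩ y.1.roots) ((isRootClosed_roots x.2.2).inter (isRootClosed_roots y.2.2))
      (Set.inter_subset_left.trans (hsub x))
  · exact key (x.1.roots ∪ y.1.roots) ((isRootClosed_roots x.2.2).union (isRootClosed_roots y.2.2))
      (Set.union_subset (hsub x) (hsub y))

theorem mainTheorem4 (k : Type v) [CommRing k] (I : Type u) [Finite I] (a b : RootedForest I)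
    (ha : IsMin a) (hb : IsMax b) (hab : a ≤ b) :
    IsCohenMacaulayPoset k (Set.Icc a b) := 
  isCohenMacaulayPoset_Icc k hab
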